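/- **Setting.** Let $\mathcal Z$ be a countably infinite data space, $\mathcal H$ a set of hypotheses and $\ell:\mathcal H\times\mathcal Z\to\mathbb R$ a loss function. Put $\mathrm{DI}(\ell):=\sup\ell-\inf\ell\in[0,+\infty]$, the supremum and infimum being over $\mathcal H\times\mathcal Z$. For a probability distribution $Q$ on $\mathcal Z$ and $\mathbf z\in\mathcal Z^n$ let $$\mathrm{GenGap}_{(\ell,Q,\mathbf z)}(h):=\mathbb E_{Z\sim Q}\,\ell(h,Z)-\frac1n\sum_{i=1}^n\ell(h,z_i).$$ (If $\mathrm{DI}(\ell)=+\infty$, the bounds on the generalization gap below are vacuous.) Let $\mathfrak A:\bigcup_{n\ge0}\mathcal Z^n\to\mathcal H$ be a symmetric learning algorithm, i.e. $\mathfrak A(z_{\sigma(1)},\dots,z_{\sigma(n)})=\mathfrak A(z_1,\dots,z_n)$ for every permutation $\sigma$. Let $H_\alpha(Q)\in[0,+\infty]$ be the Rényi entropy of order $\alpha$: $H_0(Q)=\ln|\mathrm{supp}\,Q|$, $H_1(Q)=\sum_z Q(z)\ln\frac1{Q(z)}$, and $H_\alpha(Q)=\frac1{1-\alpha}\ln\sum_zQ(z)^\alpha$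 for $0<\alpha<1$. Put $\kappa^*_Q(n):=\min_{\alpha\in[0,1]}n^\alpha\exp((1-\alpha)H_\alpha(Q))$, with $0\cdot\infty=0$ in the exponent. Assume that $Q$ decays exponentially: there are a bijection $z:\mathbb N\to\mathcal Z$ (with $\mathbb N\ni 0$), $r\in(0,1)$ and $C>0$ with $Q(z(j))\le Cr^j$ for all $j\in\mathbb N$. Put $\tilde C:=\max\{C,1\}$, and let $\mathbf Z=(Z_1,\dots,Z_n)\sim Q^n$. **(1)** For every integer $n\ge1$, $$\kappa^*_Q(n)\le\frac{e\tilde C}{\ln\frac1r}\Bigl(\ln n+\ln\frac er\Bigr).$$ **(2)** For every integer $n\ge1$ and all $\delta_1,\delta_2,\delta_3>0$, with probability at least $1-(\delta_1+\delta_2+\delta_3)$, $$\mathrm{GenGap}_{(\ell,Q,\mathbf Z)}(\mathfrak A(\mathbf Z))\le\mathrm{DI}(\ell)\sqrt{\frac{\Bigl(\frac{e\tilde C}{\ln\frac1r}(\ln n+\ln\frac er)+\sqrt{\frac n2\ln\frac2{\delta_3}}\Bigr)\Bigl(3\ln n+\ln(2\pi)+\ln\frac1{\delta_2}\Bigr)+\ln\frac1{\delta_1}}{2n}}.$$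 **(3)** Suppose $\mathrm{DI}(\ell)>0$ and let $\delta,\varepsilon\in(0,1]$. Put $$\omega(\delta,\varepsilon):=\max\left\{\frac{324\ln\frac3\delta}{\varepsilon^4}\Bigl(\ln\frac{9\sqrt{2\ln\frac3\delta}}{\varepsilon^2}\Bigr)^2,\ \frac3{2\varepsilon^2}\ln\frac3\delta\right\}$$ and $X:=\frac{36e\tilde C}{\varepsilon^2\ln\frac1r}$, $Y:=3+\frac{\ln(6\pi e^3/\delta)}{\ln\frac1r}$. If $n>\omega(\delta,\varepsilon)$ and $$n>\max\left\{X(\ln X)^2,\ \frac{12e\tilde C}{\varepsilon^2}\,Y\ln\Bigl(\frac{6e\tilde C}{\varepsilon^2}Y\Bigr),\ \frac{6e\tilde C}{\varepsilon^2}\Bigl(1+\frac1{\ln\frac1r}\Bigr)\ln\frac{2\pi}\delta\right\},$$ then with probability at least $1-\delta$, $\mathrm{GenGap}_{(\ell,Q,\mathbf Z)}(\mathfrak A(\mathbf Z))<\mathrm{DI}(\ell)\,\varepsilon$. **(4)** There is an absolute constant $K>0$ such that for all $C>0$, $r\in(0,1)$, $\delta\in(0,1]$ there is $n_0=n_0(C,r,\delta)$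 such that for all $\mathcal Z,\mathcal H,\ell,\mathfrak A,Q$ as above and all $n\ge n_0$, with probability at least $1-\delta$, $$\mathrm{GenGap}_{(\ell,Q,\mathbf Z)}(\mathfrak A(\mathbf Z))\le K\,\mathrm{DI}(\ell)\sqrt{\frac{eC}{\ln\frac1r}\cdot\frac{(\ln n)^2}{2n}}.$$ **(5)** There is an absolute constant $K>0$ such that for all $C>0$, $r\in(0,1)$, $\delta\in(0,1]$ there is $\varepsilon_0=\varepsilon_0(C,r,\delta)>0$ such that for all $\mathcal Z,\mathcal H,\ell,\mathfrak A,Q$ as above with $\mathrm{DI}(\ell)>0$, all $0<\varepsilon<\varepsilon_0$ and all $$n\ge K\,\frac1{\varepsilon^2\ln\frac1r}\Bigl(\ln\frac1\varepsilon\Bigr)^2,$$ with probability at least $1-\delta$, $\mathrm{GenGap}_{(\ell,Q,\mathbf Z)}(\mathfrak A(\mathbf Z))<\mathrm{DI}(\ell)\,\varepsilon$. -/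

import Mathlib

open MeasureTheory
open scoped ENNReal

universe u v

namespace RenyiGen

/-- The expected risk `E_{Z ∼ Q} ℓ(h, Z)`. -/
noncomputable def risk {Z : Type u} {H : Type v} [MeasurableSpace Z]
    (ℓ : H → Z → ℝ) (Q : Measure Z) (h : H) : ℝ :=
  ∫ z, ℓ h z ∂Q

/-- The empirical risk `(1/n) ∑ i, ℓ(h, z i)` of a data sequence of length `n`. -/
noncomputable def empRisk {Z : Type u} {H : Type v} (ℓ : H → Z → ℝ) {n : ℕ} (z : Fin n → Z)
    (h : H) : ℝ :=
  (1 / (n : ℝ)) * ∑ i, ℓ h (z i)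

/-- The generalization gap. -/
noncomputable def genGap {Z : Type u} {H : Type v} [MeasurableSpace Z]
    (ℓ : H → Z → ℝ) (Q : Measure Z) {n : ℕ} (z : Fin n → Z) (h : H) : ℝ :=
  risk ℓ Q h - empRisk ℓ z h

/-- The diameter of the image of the loss, `sup ℓ - inf ℓ`, an extended real number:
it is `⊤` when the loss is unbounded. -/
noncomputable def lossDiam {Z : Type u} {H : Type v} (ℓ : H → Z → ℝ) : EReal :=
  (⨆ p : H × Z, (ℓ p.1 p.2 : EReal)) - (⨅ p : H × Z, (ℓ p.1 p.2 : EReal))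

/-- A (deterministic) learning algorithm: a map from finite data sequences of arbitrary length
to hypotheses. -/
abbrev Learner (Z : Type u) (H : Type v) : Type (max u v) :=
  (n : ℕ) → (Fin n → Z) → H

/-- The algorithm does not depend on the order of the data. -/
def Learner.IsSymmetric {Z : Type u} {H : Type v} (A : Learner Z H) : Prop :=
  ∀ (n : ℕ) (σ : Equiv.Perm (Fin n)) (z : Fin n → Z), A n (fun i => z (σ i)) = A n z

/-- The law `Q^n` of `n` independent samples of `Q`. -/
noncomputable def iidLaw {Z : Type u} [MeasurableSpace Z] (Q : Measure Z) (n : ℕ) :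
    Measure (Fin n → Z) :=
  Measure.pi fun _ => Q

open Classical in
/-- The Rényi entropy of finite order `α` of a discrete probability distribution,
with values in the extended reals (it may be `⊤`). -/
noncomputable def renyiEntropy {Z : Type u} [MeasurableSpace Z] (Q : Measure Z) (α : ℝ) : EReal :=
  if α = 1 then
    ((∑' z, Q {z} * ENNReal.ofReal (Real.log (1 / (Q {z}).toReal)) : ℝ≥0∞) : EReal)
  else if α = 0 then
    ENNReal.log (({z | 0 < Q {z}} : Set Z).encard : ℝ≥0∞)
  else
    ((1 / (1 - α) : ℝ) : EReal) * ENNReal.log (∑' z, Q {z} ^ α)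

/-- `κ_(Q,α)(n) = n ^ α * exp ((1 - α) H_α(Q))`; the product `0 * ⊤`, which can occur in the
exponent for `α = 1`, is `0`. -/
noncomputable def kappa {Z : Type u} [MeasurableSpace Z] (Q : Measure Z) (α : ℝ) (n : ℕ) : ℝ≥0∞ :=
  (n : ℝ≥0∞) ^ α * EReal.exp (((1 - α : ℝ) : EReal) * renyiEntropy Q α)

/-- `κ*_Q(n)`, the least value of `κ_(Q,α)(n)` over `α ∈ [0,1]`. -/
noncomputable def kappaStar {Z : Type u} [MeasurableSpace Z] (Q : Measure Z) (n : ℕ) : ℝ≥0∞ :=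
  ⨅ α ∈ Set.Icc (0 : ℝ) 1, kappa Q α n

/-- The point masses of `Q`, listed along some bijective numbering `ℕ ≃ Z`, are at most
`C * r ^ j`. -/
def ExpDecay {Z : Type u} [MeasurableSpace Z] (Q : Measure Z) (C r : ℝ) : Prop :=
  ∃ num : ℕ ≃ Z, ∀ j : ℕ, Q.real {num j} ≤ C * r ^ j

/-- `(e C̃ / ln (1/r)) * (ln n + ln (e/r))` with `C̃ = max C 1`, the bound on `κ*_Q(n)`. -/
noncomputable def kappaBound (C r : ℝ) (n : ℕ) : ℝ :=
  Real.exp 1 * max C 1 / Real.log (1 / r) * (Real.log n + Real.log (Real.exp 1 / r))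

/-- The part `ω(δ, ε)` of the sample size that does not depend on the distribution. -/
noncomputable def omega (δ ε : ℝ) : ℝ :=
  max (324 * Real.log (3 / δ) / ε ^ 4 *
        (Real.log (9 * Real.sqrt (2 * Real.log (3 / δ)) / ε ^ 2)) ^ 2)
    (3 / (2 * ε ^ 2) * Real.log (3 / δ))

/-- The part of the sample size that depends on the decay of the distribution. -/
noncomputable def expSampleSize (C r δ ε : ℝ) : ℝ :=
  let Ct := max C 1
  let L := Real.log (1 / r)
  let X := 36 * Real.exp 1 * Ct / (ε ^ 2 * L)
  let Y := 3 + Real.log (6 * Real.pi * Real.exp 3 / δ) / L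
  max (X * (Real.log X) ^ 2)
    (max (12 * Real.exp 1 * Ct / ε ^ 2 * Y * Real.log (6 * Real.exp 1 * Ct / ε ^ 2 * Y))
      (6 * Real.exp 1 * Ct / ε ^ 2 * (1 + 1 / L) * Real.log (2 * Real.pi / δ)))

end RenyiGen

/-!
The generalization gap of any hypothesis is at most the diameter of the loss times the total
variation distance between `Q` and the empirical measure (`integral_sub_empMean_lt`), so it
suffices to bound this distance; the resulting bounds hold for all hypotheses simultaneously, hence
for the one that is learned from the sample.

When `Q` has exponential decay, then up to probability `δ₂` the whole sample lies in a set `F` of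
about `ln (n / δ₂) / ln (1 / r)` atoms. For such a sample the distance is attained by a subset of
`F`, so that Hoeffding's inequality and a union bound over the `2 ^ |F|` subsets give
`le_measureReal_uniformlyGood`: all gaps are below `t` times the diameter as soon as
`|F| ln 2 + ln (1 / δ₁) ≤ 2 n t²`.

The bounds on the gap are then numerical. For the explicit bound (`truncation_cost_le`), the
right-hand side is either at least the diameter, or it exceeds the square root of
`(|F| ln 2 + ln (1 / δ₁)) / (2 n)`; the explicit sample size is treated in
`truncation_cost_le_of_expSampleSize_lt`. In the asymptotic statements `C`, `r` and `δ` are fixed,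
so `|F| ln 2 + ln (1 / δ₁)` is an affine function of `ln n`, which is eventually dominated by
`(ln n)²`, and by `n ε²`.

The bound on `κ*` (`kappaStar_le_kappaBound`) follows from the choice `α = 1 / (ln n + 1)`, for
which `n ^ α ≤ e` and `∑ Q(z) ^ α` is at most a geometric series of ratio `r ^ α`.
-/

namespace RenyiGen

/-! ### Deviations of the empirical measure -/

/-- The fraction of the sample `z` that lies in `S`. -/
noncomputable def empFreq {Z : Type u} {n : ℕ} (z : Fin n → Z) (S : Set Z) : ℝ :=
  (1 / (n : ℝ)) * ∑ i, S.indicator 1 (z i)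

/-- Hoeffding's inequality for the empirical frequency of a fixed set. -/
theorem measureReal_le_empFreq_sub_le {Z : Type u} [MeasurableSpace Z] [DiscreteMeasurableSpace Z]
    (Q : Measure Z) [IsProbabilityMeasure Q] {n : ℕ} (hn : 0 < n) (S : Set Z) {t : ℝ}
    (ht : 0 ≤ t) :
    (iidLaw Q n).real {z | t ≤ empFreq z S - Q.real S} ≤ Real.exp (-(2 * n * t ^ 2)) := by
  have hn' : (0 : ℝ) < n := by exact_mod_cast hn
  have hint : ∫ x, S.indicator (1 : Z → ℝ) x ∂Q = Q.real S := integral_indicator_one .of_discrete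
  have hsub : ProbabilityTheory.HasSubgaussianMGF
      (fun x => S.indicator (1 : Z → ℝ) x - Q.real S) ((‖(1 : ℝ) - 0‖₊ / 2) ^ 2) Q := by
    rw [← hint]
    refine ProbabilityTheory.hasSubgaussianMGF_of_mem_Icc
      (Measurable.of_discrete).aemeasurable (.of_forall fun x => ?_)
    by_cases hx : x ∈ S <;> simp [hx]
  have hind := ProbabilityTheory.iIndepFun_pi (ι := Fin n) (μ := fun _ => Q)
    (X := fun _ x => S.indicator (1 : Z → ℝ) x - Q.real S)
    (fun _ => (Measurable.of_discrete).aemeasurable)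
  have hsubi : ∀ i ∈ (Finset.univ : Finset (Fin n)), ProbabilityTheory.HasSubgaussianMGF
      (fun z : Fin n → Z => S.indicator (1 : Z → ℝ) (z i) - Q.real S)
      ((‖(1 : ℝ) - 0‖₊ / 2) ^ 2) (Measure.pi fun _ => Q) := fun i _ => by
    refine ProbabilityTheory.HasSubgaussianMGF.of_map
      (Y := fun z : Fin n → Z => z i)
      (X := fun x => S.indicator (1 : Z → ℝ) x - Q.real S)
      (measurable_pi_apply i).aemeasurable ?_
    rw [show Measure.map (fun z : Fin n → Z => z i) (Measure.pi fun _ => Q) = Q from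
      (measurePreserving_eval (fun _ : Fin n => Q) i).map_eq]
    exact hsub
  have key := ProbabilityTheory.HasSubgaussianMGF.measure_sum_ge_le_of_iIndepFun hind hsubi
    (ε := n * t) (by positivity)
  have hset : {z : Fin n → Z | t ≤ empFreq z S - Q.real S} =
      {z | n * t ≤ ∑ i, (S.indicator (1 : Z → ℝ) (z i) - Q.real S)} := by
    ext z
    simp only [Set.mem_ofPred_eq, empFreq, Finset.sum_sub_distrib, Finset.sum_const,
      Finset.card_univ, Fintype.card_fin, nsmul_eq_mul]
    rw [show (1 / (n : ℝ)) * ∑ i, S.indicator (1 : Z → ℝ) (z i) - Q.real S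
      = (∑ i, S.indicator (1 : Z → ℝ) (z i) - n * Q.real S) / n by field_simp]
    rw [le_div_iff₀ hn', mul_comm]
  rw [hset]
  refine key.trans (le_of_eq ?_)
  congr 1
  simp
  field_simp

theorem measureReal_exists_mem_le {Z : Type u} [MeasurableSpace Z] [DiscreteMeasurableSpace Z]
    (Q : Measure Z) [IsProbabilityMeasure Q] (n : ℕ) (T : Set Z) :
    (iidLaw Q n).real {z | ∃ i, z i ∈ T} ≤ n * Q.real T := by
  have hset : {z : Fin n → Z | ∃ i, z i ∈ T} = ⋃ i, (Function.eval i) ⁻¹' T := by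
    ext z; simp
  rw [hset]
  refine (measureReal_iUnion_fintype_le _).trans (le_of_eq ?_)
  have : ∀ i : Fin n, (iidLaw Q n).real ((Function.eval i) ⁻¹' T) = Q.real T := fun i => by
    rw [iidLaw]
    exact (measurePreserving_eval (fun _ : Fin n => Q) i).measureReal_preimage
      (MeasurableSet.of_discrete).nullMeasurableSet
  simp [this]

theorem integrable_of_mem_Icc {Z : Type u} [MeasurableSpace Z] [DiscreteMeasurableSpace Z]
    [Countable Z] (Q : Measure Z) [IsProbabilityMeasure Q] {a b : ℝ} {f : Z → ℝ}
    (hf : ∀ x, f x ∈ Set.Icc a b) : Integrable f Q :=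
  Integrable.of_mem_Icc a b (Measurable.of_discrete).aemeasurable (.of_forall hf)

/-- The difference between mean and empirical mean is at most the length of the range, times the
largest deviation of the empirical frequency. This is the duality between bounded functions and
the total variation distance: after replacing `f` by `b - f ≥ 0`, the atoms that are under-sampled
may be dropped, and on the others the function may be replaced by `b - a`. -/
theorem integral_sub_empMean_lt {Z : Type u} [MeasurableSpace Z] [DiscreteMeasurableSpace Z]
    [Countable Z] (Q : Measure Z) [IsProbabilityMeasure Q] {n : ℕ} (hn : 0 < n) {z : Fin n → Z}
    {F : Finset Z} (hz : ∀ i, z i ∈ F) {t : ℝ}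
    (hS : ∀ S ⊆ F, empFreq z (S : Set Z) - Q.real (S : Set Z) < t)
    {f : Z → ℝ} {a b : ℝ} (hab : a < b) (hf : ∀ x, f x ∈ Set.Icc a b) :
    ∫ x, f x ∂Q - (1 / (n : ℝ)) * ∑ i, f (z i) < (b - a) * t := by
  classical
  have hn' : (0 : ℝ) < n := by exact_mod_cast hn
  set g : Z → ℝ := fun x => b - f x with hg
  have hg0 : ∀ x, 0 ≤ g x := fun x => sub_nonneg.2 (hf x).2
  have hgD : ∀ x, g x ≤ b - a := fun x => sub_le_sub_left (hf x).1 b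
  have hfi := integrable_of_mem_Icc Q hf
  have hgi : Integrable g Q := integrable_of_mem_Icc Q fun x => ⟨hg0 x, hgD x⟩
  have hfreq : ∀ S : Finset Z, empFreq z (S : Set Z) = ∑ x ∈ S, empFreq z {x} := fun S => by
    simp only [empFreq]
    rw [← Finset.mul_sum, Finset.sum_comm]
    congr 1
    refine Finset.sum_congr rfl fun i _ => ?_
    simp [Set.indicator_apply]
  have hQ : ∀ S : Finset Z, Q.real (S : Set Z) = ∑ x ∈ S, Q.real {x} := fun S =>
    (sum_measureReal_singleton S).symm
  have hEg : ∫ x, g x ∂Q = b - ∫ x, f x ∂Q := by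
    simp [hg, integral_sub (integrable_const b) hfi]
  have hPg : (1 / (n : ℝ)) * ∑ i, g (z i) = b - (1 / (n : ℝ)) * ∑ i, f (z i) := by
    simp only [hg, Finset.sum_sub_distrib, Finset.sum_const, Finset.card_univ, Fintype.card_fin,
      nsmul_eq_mul]
    field_simp
  have hPg' : (1 / (n : ℝ)) * ∑ i, g (z i) = ∑ x ∈ F, g x * empFreq z {x} := by
    simp only [empFreq]
    simp_rw [mul_left_comm (g _)]
    rw [← Finset.mul_sum]
    congr 1
    simp_rw [Finset.mul_sum]
    rw [Finset.sum_comm]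
    refine Finset.sum_congr rfl fun i _ => ?_
    simp [Set.indicator_apply, hz i]
  have hEg' : ∑ x ∈ F, g x * Q.real {x} ≤ ∫ x, g x ∂Q := by
    have : ∑ x ∈ F, g x * Q.real {x} = ∫ x in (F : Set Z), g x ∂Q := by
      rw [setIntegral_finset F hgi.integrableOn]
      simp [mul_comm]
    rw [this]
    exact setIntegral_le_integral hgi (.of_forall hg0)
  set S : Finset Z := F.filter fun x => 0 ≤ empFreq z {x} - Q.real {x} with hSdef
  have h1 : ∑ x ∈ F, g x * (empFreq z {x} - Q.real {x})
      ≤ ∑ x ∈ S, (b - a) * (empFreq z {x} - Q.real {x}) := by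
    rw [hSdef, Finset.sum_filter]
    refine Finset.sum_le_sum fun x _ => ?_
    split_ifs with h
    · exact mul_le_mul_of_nonneg_right (hgD x) h
    · exact mul_nonpos_of_nonneg_of_nonpos (hg0 x) (le_of_not_ge h)
  have h2 : ∑ x ∈ S, (b - a) * (empFreq z {x} - Q.real {x})
      = (b - a) * (empFreq z (S : Set Z) - Q.real (S : Set Z)) := by
    rw [hfreq, hQ, ← Finset.sum_sub_distrib, Finset.mul_sum]
  have h3 := mul_lt_mul_of_pos_left (hS S (Finset.filter_subset _ _)) (sub_pos.2 hab)
  simp only [mul_sub, Finset.sum_sub_distrib] at h1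
  simp only [mul_sub, Finset.sum_sub_distrib] at h2 h3
  linarith

/-- Samples for which every hypothesis of every bounded loss has a generalization gap smaller than
`t` times the range of the loss. -/
def uniformlyGood {Z : Type u} [MeasurableSpace Z] (Q : Measure Z) (n : ℕ) (t : ℝ) :
    Set (Fin n → Z) :=
  {z | ∀ (f : Z → ℝ) (a b : ℝ), a < b → (∀ x, f x ∈ Set.Icc a b) →
    ∫ x, f x ∂Q - (1 / (n : ℝ)) * ∑ i, f (z i) < (b - a) * t}

/-- All bounded functions on a countable space generalize simultaneously, up to the mass outside a
finite set `F`: only the `2 ^ |F|` subsets of `F` enter the union bound. -/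
theorem le_measureReal_uniformlyGood_of_finset {Z : Type u} [MeasurableSpace Z]
    [DiscreteMeasurableSpace Z] [Countable Z] (Q : Measure Z) [IsProbabilityMeasure Q] {n : ℕ}
    (hn : 0 < n) (F : Finset Z) {t : ℝ} (ht : 0 ≤ t) :
    1 - (n * Q.real (F : Set Z)ᶜ + 2 ^ F.card * Real.exp (-(2 * n * t ^ 2))) ≤
      (iidLaw Q n).real (uniformlyGood Q n t) := by
  have : IsProbabilityMeasure (iidLaw Q n) := by unfold iidLaw; infer_instance
  set G := uniformlyGood Q n t
  have hsub : Gᶜ ⊆ {z | ∃ i, z i ∈ (F : Set Z)ᶜ} ∪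
      ⋃ S ∈ F.powerset, {z | t ≤ empFreq z (S : Set Z) - Q.real (S : Set Z)} := by
    intro z hz
    by_contra hcon
    simp only [Set.mem_union, Set.mem_ofPred_eq, Set.mem_compl_iff, Finset.mem_coe, Set.mem_iUnion,
      Finset.mem_powerset, exists_prop, not_or, not_exists, not_and, not_not, not_le] at hcon
    exact hz fun f a b hab hf => integral_sub_empMean_lt Q hn hcon.1 hcon.2 hab hf
  have h1 : (iidLaw Q n).real Gᶜ ≤
      n * Q.real (F : Set Z)ᶜ + 2 ^ F.card * Real.exp (-(2 * n * t ^ 2)) := by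
    refine (measureReal_mono hsub).trans ((measureReal_union_le _ _).trans (add_le_add
      (measureReal_exists_mem_le Q n _) ((measureReal_biUnion_finset_le _ _).trans ?_)))
    have h : ∀ S ∈ F.powerset, (iidLaw Q n).real
        {z | t ≤ empFreq z (S : Set Z) - Q.real (S : Set Z)} ≤ Real.exp (-(2 * n * t ^ 2)) :=
      fun S _ => measureReal_le_empFreq_sub_le Q hn (S : Set Z) ht
    refine (Finset.sum_le_sum h).trans (le_of_eq ?_)
    simp [Finset.card_powerset]
  have h2 : (iidLaw Q n).real Gᶜ = 1 - (iidLaw Q n).real G :=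
    probReal_compl_eq_one_sub .of_discrete
  linarith

/-! ### Truncation of an exponentially decaying distribution -/

theorem measureReal_compl_image_range_le {Z : Type u} [MeasurableSpace Z] [DecidableEq Z]
    (Q : Measure Z) [IsProbabilityMeasure Q] {C r : ℝ} (hC : 0 < C) (hr0 : 0 < r) (hr1 : r < 1)
    {num : ℕ ≃ Z} (hnum : ∀ j : ℕ, Q.real {num j} ≤ C * r ^ j) (M : ℕ) :
    Q.real ((((Finset.range M).image num : Finset Z) : Set Z)ᶜ) ≤ C * r ^ M / (1 - r) := by
  have hset : ((((Finset.range M).image num : Finset Z) : Set Z)ᶜ) ⊆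
      ⋃ j : ℕ, {num (j + M)} := by
    intro x hx
    simp only [Finset.coe_image, Set.mem_compl_iff, Set.mem_image, Finset.coe_range, Set.mem_Iio,
      not_exists, not_and] at hx
    have hM : M ≤ num.symm x := by
      by_contra h
      exact hx _ (not_le.1 h) (num.apply_symm_apply x)
    refine Set.mem_iUnion.2 ⟨num.symm x - M, ?_⟩
    simp [Nat.sub_add_cancel hM]
  have hs : HasSum (fun j : ℕ => C * r ^ (j + M)) (C * r ^ M / (1 - r)) := by
    have := (hasSum_geometric_of_lt_one hr0.le hr1).mul_left (C * r ^ M)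
    refine (this.congr_fun ?_)
    intro j
    rw [pow_add]; ring
  have hQ : Q ((((Finset.range M).image num : Finset Z) : Set Z)ᶜ) ≤
      ENNReal.ofReal (C * r ^ M / (1 - r)) := by
    refine (measure_mono hset).trans ((measure_iUnion_le _).trans ?_)
    rw [← hs.tsum_eq, ENNReal.ofReal_tsum_of_nonneg (fun j => by positivity) hs.summable]
    refine ENNReal.tsum_le_tsum fun j => ?_
    rw [← ofReal_measureReal]
    exact ENNReal.ofReal_le_ofReal (hnum _)
  exact ENNReal.toReal_le_of_le_ofReal (div_nonneg (by positivity) (sub_pos.2 hr1).le) hQ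

/-- With `s = exp (-x)` this is `1 + x ≤ exp x`. -/
theorem inv_one_sub_le_one_add_inv_log {s : ℝ} (hs0 : 0 < s) (hs1 : s < 1) :
    (1 - s)⁻¹ ≤ 1 + 1 / Real.log (1 / s) := by
  have hL : 0 < Real.log (1 / s) := Real.log_pos (by rw [lt_div_iff₀ hs0]; linarith)
  have h1 : Real.log (1 / s) ≤ 1 / s - 1 := Real.log_le_sub_one_of_pos (by positivity)
  have h2 : 1 / (1 / s - 1) ≤ 1 / Real.log (1 / s) := one_div_le_one_div_of_le hL h1
  have h3 : (1 - s)⁻¹ = 1 + 1 / (1 / s - 1) := by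
    have : 1 - s ≠ 0 := by linarith
    have : 1 / s - 1 ≠ 0 := by
      have : 1 < 1 / s := by rw [lt_div_iff₀ hs0]; linarith
      linarith
    field_simp
    ring
  linarith

theorem log_one_div_pos {r : ℝ} (hr0 : 0 < r) (hr1 : r < 1) : 0 < Real.log (1 / r) :=
  Real.log_pos (by rw [lt_div_iff₀ hr0]; linarith)

/-- Truncating the distribution at about `ln (n / δ₂) / ln (1 / r)` atoms loses probability at
most `δ₂`; the union bound over the sets of remaining atoms loses `δ₁`. The left-hand side of
`hcrit` is called the truncation cost below; its first factor bounds the number of atoms kept. -/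
theorem le_measureReal_uniformlyGood {Z : Type u} [MeasurableSpace Z] [DiscreteMeasurableSpace Z]
    (Q : Measure Z) [IsProbabilityMeasure Q] {C r : ℝ} (hr0 : 0 < r) (hr1 : r < 1)
    (hE : ExpDecay Q C r) {n : ℕ} (hn : 0 < n) {t δ₁ δ₂ : ℝ} (ht : 0 ≤ t) (hδ₁ : 0 < δ₁)
    (hδ₂ : 0 < δ₂) (hδ₂' : δ₂ ≤ 1)
    (hcrit : (1 + (Real.log n + Real.log (max C 1) + Real.log (1 + 1 / Real.log (1 / r)) +
      Real.log (1 / δ₂)) / Real.log (1 / r)) * Real.log 2 + Real.log (1 / δ₁)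
        ≤ 2 * n * t ^ 2) :
    1 - (δ₁ + δ₂) ≤ (iidLaw Q n).real (uniformlyGood Q n t) := by
  classical
  obtain ⟨num, hnum⟩ := hE
  have hcount : Countable Z := num.symm.injective.countable
  set L := Real.log (1 / r) with hLdef
  have hL : 0 < L := log_one_div_pos hr0 hr1
  set D := max C 1 with hDdef
  have hD1 : 1 ≤ D := le_max_right _ _
  have hD0 : 0 < D := by linarith
  have hn' : (1 : ℝ) ≤ n := by exact_mod_cast hn
  have hnD : ∀ j : ℕ, Q.real {num j} ≤ D * r ^ j := fun j =>
    (hnum j).trans (mul_le_mul_of_nonneg_right (le_max_left _ _) (by positivity))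
  have h1L : 0 < 1 + 1 / L := by positivity
  set y := Real.log n + Real.log D + Real.log (1 + 1 / L) + Real.log (1 / δ₂) with hy
  have hy0 : 0 ≤ y := by
    have h1 := Real.log_nonneg hn'
    have h2 := Real.log_nonneg hD1
    have h3 : 0 ≤ Real.log (1 + 1 / L) := Real.log_nonneg (by
      have : 0 < 1 / L := by positivity
      linarith)
    have h4 : 0 ≤ Real.log (1 / δ₂) := Real.log_nonneg (by rw [le_div_iff₀ hδ₂]; linarith)
    positivity
  set M := ⌈y / L⌉₊ with hM
  have hM1 : y / L ≤ M := Nat.le_ceil _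
  have hM2 : (M : ℝ) ≤ 1 + y / L := by
    have := (Nat.ceil_lt_add_one (div_nonneg hy0 hL.le)).le
    linarith
  have hrM : r ^ M ≤ δ₂ / (n * D * (1 + 1 / L)) := by
    have hrexp : r ^ M = Real.exp (-(M * L)) := by
      rw [hLdef, one_div, Real.log_inv, mul_neg, neg_neg, mul_comm, Real.exp_mul,
        Real.exp_log hr0, Real.rpow_natCast]
    rw [hrexp, ← Real.exp_log (show 0 < δ₂ / (n * D * (1 + 1 / L)) by positivity)]
    refine Real.exp_le_exp.2 ?_
    rw [Real.log_div hδ₂.ne' (by positivity), Real.log_mul (by positivity) (by positivity),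
      Real.log_mul (by positivity) (by positivity)]
    have h4 : Real.log (1 / δ₂) = - Real.log δ₂ := by rw [one_div, Real.log_inv]
    have h5 : y ≤ M * L := (div_le_iff₀ hL).1 hM1
    linarith
  have htail : n * (D * r ^ M / (1 - r)) ≤ δ₂ := by
    have h1 := inv_one_sub_le_one_add_inv_log hr0 hr1
    have h2 : (0 : ℝ) < 1 - r := by linarith
    calc n * (D * r ^ M / (1 - r)) = n * D * r ^ M * (1 - r)⁻¹ := by
          rw [div_eq_mul_inv]; ring
      _ ≤ n * D * (δ₂ / (n * D * (1 + 1 / L))) * (1 + 1 / L) := by gcongr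
      _ = δ₂ := by field_simp
  have hunion : 2 ^ M * Real.exp (-(2 * n * t ^ 2)) ≤ δ₁ := by
    have h2M : (2 : ℝ) ^ M = Real.exp (M * Real.log 2) := by
      rw [mul_comm, Real.exp_mul, Real.exp_log two_pos, Real.rpow_natCast]
    rw [h2M, ← Real.exp_add, ← Real.le_log_iff_exp_le hδ₁]
    have h4 : Real.log (1 / δ₁) = - Real.log δ₁ := by rw [one_div, Real.log_inv]
    have h5 := mul_le_mul_of_nonneg_right hM2 (Real.log_nonneg one_le_two)
    linarith
  have hcore := le_measureReal_uniformlyGood_of_finset Q hn ((Finset.range M).image num) ht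
  rw [Finset.card_image_of_injective _ num.injective, Finset.card_range] at hcore
  have htail' := mul_le_mul_of_nonneg_left
    (measureReal_compl_image_range_le Q hD0 hr0 hr1 hnD M) (show (0 : ℝ) ≤ n by positivity)
  refine le_trans ?_ hcore
  linarith

/-! ### The diameter of the loss -/

/-- Either the loss is unbounded, or its diameter is the length of the smallest interval that
contains its values. -/
theorem lossDiam_eq_top_or {Z : Type u} {H : Type v} [Nonempty Z] [Nonempty H] (ℓ : H → Z → ℝ) :
    lossDiam ℓ = ⊤ ∨ ∃ a b : ℝ, a ≤ b ∧ lossDiam ℓ = ((b - a : ℝ) : EReal) ∧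
      ∀ h z, ℓ h z ∈ Set.Icc a b := by
  obtain ⟨h₀⟩ := ‹Nonempty H›
  obtain ⟨z₀⟩ := ‹Nonempty Z›
  have hs : ∀ h z, (ℓ h z : EReal) ≤ ⨆ p : H × Z, (ℓ p.1 p.2 : EReal) := fun h z =>
    le_iSup (fun p : H × Z => (ℓ p.1 p.2 : EReal)) (h, z)
  have hi : ∀ h z, (⨅ p : H × Z, (ℓ p.1 p.2 : EReal)) ≤ (ℓ h z : EReal) := fun h z =>
    iInf_le (fun p : H × Z => (ℓ p.1 p.2 : EReal)) (h, z)
  unfold lossDiam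
  generalize (⨆ p : H × Z, (ℓ p.1 p.2 : EReal)) = s at *
  generalize (⨅ p : H × Z, (ℓ p.1 p.2 : EReal)) = i at *
  induction s with
  | bot => exact absurd (hs h₀ z₀) (by simp)
  | top =>
    left
    induction i with
    | bot => simp
    | top => exact absurd (hi h₀ z₀) (by simp)
    | coe a => simp
  | coe b =>
    induction i with
    | bot => left; simp
    | top => exact absurd (hi h₀ z₀) (by simp)
    | coe a =>
      right
      have hmem : ∀ h z, ℓ h z ∈ Set.Icc a b := fun h z =>
        ⟨EReal.coe_le_coe_iff.1 (hi h z), EReal.coe_le_coe_iff.1 (hs h z)⟩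
      exact ⟨a, b, (hmem h₀ z₀).1.trans (hmem h₀ z₀).2, by simp, hmem⟩

theorem genGap_lt_of_mem_uniformlyGood {Z : Type u} {H : Type v} [MeasurableSpace Z] [Nonempty Z]
    {Q : Measure Z} {n : ℕ} {t : ℝ} (ht : 0 < t) {z : Fin n → Z} (hz : z ∈ uniformlyGood Q n t)
    (ℓ : H → Z → ℝ) (hℓ : 0 < lossDiam ℓ) (h : H) :
    (genGap ℓ Q z h : EReal) < lossDiam ℓ * (t : EReal) := by
  have : Nonempty H := ⟨h⟩
  obtain htop | ⟨a, b, -, hd, hmem⟩ := lossDiam_eq_top_or ℓ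
  · rw [htop, EReal.top_mul_coe_of_pos ht]
    exact EReal.coe_lt_top _
  · rw [hd] at hℓ ⊢
    rw [← EReal.coe_mul]
    exact EReal.coe_lt_coe_iff.2
      (hz (ℓ h) a b (sub_pos.1 (EReal.coe_pos.1 hℓ)) (hmem h))

theorem genGap_le_lossDiam {Z : Type u} {H : Type v} [MeasurableSpace Z]
    [DiscreteMeasurableSpace Z] [Countable Z] [Nonempty Z]
    (Q : Measure Z) [IsProbabilityMeasure Q] {n : ℕ} (hn : 0 < n) (z : Fin n → Z)
    (ℓ : H → Z → ℝ) (h : H) :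
    (genGap ℓ Q z h : EReal) ≤ lossDiam ℓ := by
  have : Nonempty H := ⟨h⟩
  obtain htop | ⟨a, b, -, hd, hmem⟩ := lossDiam_eq_top_or ℓ
  · rw [htop]
    exact le_top
  · rw [hd]
    refine EReal.coe_le_coe_iff.2 ?_
    have hn' : (0 : ℝ) < n := by exact_mod_cast hn
    have h1 : ∫ x, ℓ h x ∂Q ≤ b := by
      have := integral_mono (integrable_of_mem_Icc Q (hmem h)) (integrable_const b)
        fun x => (hmem h x).2
      simpa using this
    have h2 : a ≤ (1 / (n : ℝ)) * ∑ i, ℓ h (z i) := by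
      have := Finset.card_nsmul_le_sum Finset.univ (fun i => ℓ h (z i)) a fun i _ => (hmem h _).1
      simp only [Finset.card_univ, Fintype.card_fin, nsmul_eq_mul] at this
      rw [one_div, ← div_eq_inv_mul, le_div_iff₀ hn']
      linarith
    unfold genGap risk empRisk
    linarith

/-- For a loss of diameter `0` the strict bound fails, but the gap vanishes. -/
theorem genGap_le_of_mem_uniformlyGood {Z : Type u} {H : Type v} [MeasurableSpace Z]
    [DiscreteMeasurableSpace Z] [Countable Z] [Nonempty Z]
    {Q : Measure Z} [IsProbabilityMeasure Q] {n : ℕ} (hn : 0 < n) {t : ℝ} (ht : 0 < t)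
    {z : Fin n → Z} (hz : z ∈ uniformlyGood Q n t) (ℓ : H → Z → ℝ) (h : H) :
    (genGap ℓ Q z h : EReal) ≤ lossDiam ℓ * (t : EReal) := by
  have : Nonempty H := ⟨h⟩
  obtain hpos | hzero := lt_or_ge 0 (lossDiam ℓ)
  · exact (genGap_lt_of_mem_uniformlyGood ht hz ℓ hpos h).le
  · have h0 : lossDiam ℓ = 0 := by
      refine le_antisymm hzero ?_
      obtain htop | ⟨a, b, hab, hd, -⟩ := lossDiam_eq_top_or ℓ
      · rw [htop]; exact le_top
      · rw [hd]; exact EReal.coe_nonneg.2 (sub_nonneg.2 hab)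
    have := genGap_le_lossDiam Q hn z ℓ h
    rw [h0] at this ⊢
    simpa using this

/-! ### The bound on `κ*` -/

theorem log_exp_one_div {r : ℝ} (hr0 : 0 < r) :
    Real.log (Real.exp 1 / r) = 1 + Real.log (1 / r) := by
  rw [Real.log_div (Real.exp_pos 1).ne' hr0.ne', Real.log_exp, one_div, Real.log_inv]
  ring

theorem kappaBound_eq {C r : ℝ} (hr0 : 0 < r) (n : ℕ) :
    kappaBound C r n = Real.exp 1 * max C 1 / Real.log (1 / r) *
      (Real.log n + (1 + Real.log (1 / r))) := by
  rw [kappaBound, log_exp_one_div hr0]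

theorem kappa_eq_of_pos_of_lt_one {Z : Type u} [MeasurableSpace Z] (Q : Measure Z) {α : ℝ}
    (h0 : 0 < α) (h1 : α < 1) (n : ℕ) :
    kappa Q α n = (n : ℝ≥0∞) ^ α * ∑' z, Q {z} ^ α := by
  have h : (1 - α) * (1 / (1 - α)) = 1 := by
    have : 1 - α ≠ 0 := by linarith
    field_simp
  rw [kappa, renyiEntropy, if_neg h1.ne, if_neg h0.ne', ← mul_assoc, ← EReal.coe_mul, h,
    EReal.coe_one, one_mul, ENNReal.exp_log]

theorem tsum_measure_rpow_le {Z : Type u} [MeasurableSpace Z] (Q : Measure Z)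
    [IsProbabilityMeasure Q] {C r : ℝ} (hr0 : 0 < r) (hr1 : r < 1) (hE : ExpDecay Q C r) {α : ℝ}
    (h0 : 0 < α) (h1 : α ≤ 1) :
    ∑' z, Q {z} ^ α ≤ ENNReal.ofReal (max C 1 * (1 + 1 / (α * Real.log (1 / r)))) := by
  obtain ⟨num, hnum⟩ := hE
  set D := max C 1 with hD
  have hD1 : 1 ≤ D := le_max_right _ _
  have hD0 : 0 < D := by linarith
  have hs0 : 0 < r ^ α := Real.rpow_pos_of_pos hr0 α
  have hs1 : r ^ α < 1 := Real.rpow_lt_one hr0.le hr1 h0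
  have hgeo := (hasSum_geometric_of_lt_one hs0.le hs1).mul_left D
  have hterm : ∀ j : ℕ, Q {num j} ^ α ≤ ENNReal.ofReal (D * (r ^ α) ^ j) := fun j => by
    have hQ : Q {num j} ≤ ENNReal.ofReal (D * r ^ j) := by
      rw [← ofReal_measureReal]
      exact ENNReal.ofReal_le_ofReal ((hnum j).trans
        (mul_le_mul_of_nonneg_right (le_max_left _ _) (by positivity)))
    refine (ENNReal.rpow_le_rpow hQ h0.le).trans ?_
    rw [ENNReal.ofReal_rpow_of_pos (by positivity)]
    refine ENNReal.ofReal_le_ofReal ?_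
    rw [Real.mul_rpow hD0.le (by positivity), ← Real.rpow_natCast, ← Real.rpow_natCast,
      ← Real.rpow_mul hr0.le, ← Real.rpow_mul hr0.le, mul_comm (j : ℝ) α]
    refine mul_le_mul_of_nonneg_right ?_ (by positivity)
    simpa using Real.rpow_le_rpow_of_exponent_le hD1 h1
  rw [← num.tsum_eq fun z => Q {z} ^ α]
  refine (ENNReal.tsum_le_tsum hterm).trans ?_
  rw [← ENNReal.ofReal_tsum_of_nonneg (fun j => by positivity) hgeo.summable, hgeo.tsum_eq]
  refine ENNReal.ofReal_le_ofReal (mul_le_mul_of_nonneg_left ?_ hD0.le)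
  have := inv_one_sub_le_one_add_inv_log hs0 hs1
  rwa [show Real.log (1 / r ^ α) = α * Real.log (1 / r) by
    rw [one_div, one_div, Real.log_inv, Real.log_inv, Real.log_rpow hr0]; ring] at this

/-- The order `α = 1 / (ln n + 1)` balances `n ^ α ≤ e` against the power sum of the masses. -/
theorem kappaStar_le_kappaBound {Z : Type u} [MeasurableSpace Z] (Q : Measure Z)
    [IsProbabilityMeasure Q] {C r : ℝ} (hr0 : 0 < r) (hr1 : r < 1) (hE : ExpDecay Q C r) {n : ℕ}
    (hn : 0 < n) : kappaStar Q n ≤ ENNReal.ofReal (kappaBound C r n) := by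
  have hL : 0 < Real.log (1 / r) := log_one_div_pos hr0 hr1
  have hD1 : 1 ≤ max C 1 := le_max_right _ _
  have he : 1 ≤ Real.exp 1 := Real.one_le_exp zero_le_one
  rw [kappaBound_eq hr0]
  set L := Real.log (1 / r)
  set D := max C 1
  obtain rfl | hn1 := (Nat.succ_le_of_lt hn).eq_or_lt
  · -- for a single sample the balancing order is the Shannon order `1`, where `κ = n`
    refine (iInf₂_le (1 : ℝ) (by simp)).trans ?_
    have hk : kappa Q 1 1 = 1 := by simp [kappa]
    rw [Nat.succ_eq_add_one, zero_add, hk, ENNReal.one_le_ofReal]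
    have h1 : 1 ≤ Real.exp 1 * D := one_le_mul_of_one_le_of_one_le he hD1
    rw [div_mul_eq_mul_div, le_div_iff₀ hL]
    simp only [Nat.cast_one, Real.log_one, zero_add]
    nlinarith
  · have hn1' : (1 : ℝ) < n := by exact_mod_cast hn1
    have ha : 0 < Real.log n := Real.log_pos hn1'
    set α : ℝ := 1 / (Real.log n + 1) with hα
    have hα0 : 0 < α := by positivity
    have hα1 : α < 1 := by rw [hα, div_lt_one (by positivity)]; linarith
    refine (iInf₂_le α ⟨hα0.le, hα1.le⟩).trans ?_
    rw [kappa_eq_of_pos_of_lt_one Q hα0 hα1]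
    have hpow : (n : ℝ≥0∞) ^ α ≤ ENNReal.ofReal (Real.exp 1) := by
      rw [← ENNReal.ofReal_natCast, ENNReal.ofReal_rpow_of_pos (by positivity)]
      refine ENNReal.ofReal_le_ofReal ?_
      rw [Real.rpow_def_of_pos (by positivity)]
      refine Real.exp_le_exp.2 ?_
      rw [hα, mul_one_div, div_le_one (by positivity)]
      linarith
    refine (mul_le_mul' hpow (tsum_measure_rpow_le Q hr0 hr1 hE hα0 hα1.le)).trans ?_
    rw [← ENNReal.ofReal_mul (Real.exp_pos 1).le]
    refine ENNReal.ofReal_le_ofReal (le_of_eq ?_)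
    change Real.exp 1 * (D * (1 + 1 / (α * L))) = _
    rw [hα]
    field_simp
    ring

/-! ### Numerical conditions on the sample size -/

theorem log_one_div_nonneg {δ : ℝ} (h0 : 0 < δ) (h1 : δ ≤ 1) : 0 ≤ Real.log (1 / δ) :=
  Real.log_nonneg (by rw [le_div_iff₀ h0]; linarith)

theorem one_le_log_two_pi : 1 ≤ Real.log (2 * Real.pi) := by
  rw [Real.le_log_iff_exp_le (by positivity)]
  linarith [Real.exp_one_lt_d9, Real.pi_gt_three]

theorem log_two_le_one : Real.log 2 ≤ 1 := by linarith [Real.log_two_lt_d9]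

/-- As soon as the bound `R` is nontrivial, it dominates the cost of the truncation. -/
theorem truncation_cost_le {L D n δ₁ δ₂ s : ℝ} (hL : 0 < L) (hD : 1 ≤ D) (hn : 1 ≤ n)
    (hδ₁ : 0 < δ₁) (hδ₁' : δ₁ ≤ 1) (hδ₂ : 0 < δ₂) (hδ₂' : δ₂ ≤ 1) (hs : 0 ≤ s)
    (hR : (Real.exp 1 * D / L * (Real.log n + (1 + L)) + s) *
      (3 * Real.log n + Real.log (2 * Real.pi) + Real.log (1 / δ₂)) + Real.log (1 / δ₁) < 2 * n) :
    (1 + (Real.log n + Real.log D + Real.log (1 + 1 / L) + Real.log (1 / δ₂)) / L) * Real.log 2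
      + Real.log (1 / δ₁) ≤
    (Real.exp 1 * D / L * (Real.log n + (1 + L)) + s) *
      (3 * Real.log n + Real.log (2 * Real.pi) + Real.log (1 / δ₂)) + Real.log (1 / δ₁) := by
  have hd1 := log_one_div_nonneg hδ₁ hδ₁'
  have hd2 := log_one_div_nonneg hδ₂ hδ₂'
  have ha : 0 ≤ Real.log n := Real.log_nonneg hn
  have hp := one_le_log_two_pi
  have he : 2 ≤ Real.exp 1 := by linarith [Real.exp_one_gt_d9]
  have hlogD : Real.log D ≤ D := by
    linarith [Real.log_le_sub_one_of_pos (show 0 < D by linarith)]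
  have hlogD0 : 0 ≤ Real.log D := Real.log_nonneg hD
  set u := 1 / L with hu
  have hu0 : 0 < u := by positivity
  have huL : u * L = 1 := by rw [hu]; field_simp
  have hB : 2 * D * (1 + u) ≤ Real.exp 1 * D / L * (Real.log n + (1 + L)) + s := by
    have h1 : Real.exp 1 * D / L * (Real.log n + (1 + L)) =
        Real.exp 1 * (D * (u * Real.log n + (1 + u))) := by
      rw [hu]; field_simp; ring
    have h2 : D * (1 + u) ≤ D * (u * Real.log n + (1 + u)) :=
      mul_le_mul_of_nonneg_left (by nlinarith) (by linarith)
    have h3 : 0 ≤ D * (1 + u) := by positivity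
    rw [h1]
    nlinarith
  have hR' : 2 * D * (1 + u) * (3 * Real.log n + 1 + Real.log (1 / δ₂)) ≤
      (Real.exp 1 * D / L * (Real.log n + (1 + L)) + s) *
      (3 * Real.log n + Real.log (2 * Real.pi) + Real.log (1 / δ₂)) :=
    mul_le_mul hB (by linarith) (by positivity) (le_trans (by positivity) hB)
  have hun : 1 + u ≤ n := by
    have h1 : 2 * D * (1 + u) * 1 ≤
        2 * D * (1 + u) * (3 * Real.log n + 1 + Real.log (1 / δ₂)) :=
      mul_le_mul_of_nonneg_left (by linarith) (by positivity)
    nlinarith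
  have hlogu : Real.log (1 + u) ≤ Real.log n := Real.log_le_log (by positivity) hun
  have hlogu0 : 0 ≤ Real.log (1 + u) := Real.log_nonneg (by linarith)
  have hmain : (1 + (Real.log n + Real.log D + Real.log (1 + u) + Real.log (1 / δ₂)) / L)
      * Real.log 2 ≤ 2 * D * (1 + u) * (3 * Real.log n + 1 + Real.log (1 / δ₂)) := by
    refine (mul_le_of_le_one_right (by positivity) log_two_le_one).trans ?_
    rw [div_eq_mul_one_div, ← hu]
    have h1 : (Real.log n + Real.log D + Real.log (1 + u) + Real.log (1 / δ₂)) * u ≤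
        (2 * Real.log n + D + Real.log (1 / δ₂)) * u :=
      mul_le_mul_of_nonneg_right (by linarith) hu0.le
    have h2 : (1 + u) * (3 * Real.log n + 1 + Real.log (1 / δ₂)) ≤
        D * ((1 + u) * (3 * Real.log n + 1 + Real.log (1 / δ₂))) :=
      le_mul_of_one_le_left (by positivity) hD
    have h3 : D * u ≤ D * ((1 + u) * (3 * Real.log n + 1 + Real.log (1 / δ₂))) := by
      refine mul_le_mul_of_nonneg_left ?_ (by linarith)
      nlinarith [mul_nonneg hu0.le ha, mul_nonneg hu0.le hd2]
    nlinarith [mul_nonneg hu0.le ha, mul_nonneg hu0.le hd2]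
  linarith

/-- Solves `W ln n ≤ n` for `n`. -/
theorem mul_log_le_of_lt {W n : ℝ} (hW : 0 < W) (hn : 1 ≤ n) (h : 2 * W * Real.log W < n) :
    W * Real.log n ≤ n := by
  have hn0 : 0 < n := by linarith
  obtain hc | hc := le_or_gt (W ^ 2) n
  · set y := Real.sqrt n with hy
    have hy0 : 0 < y := Real.sqrt_pos.2 hn0
    have hyn : y ^ 2 = n := Real.sq_sqrt hn0.le
    have hWy : W ≤ y := Real.le_sqrt_of_sq_le hc
    have hlog : Real.log n ≤ y := by
      have h1 := Real.log_le_sub_one_of_pos (show 0 < y / 2 by positivity)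
      rw [Real.log_div hy0.ne' two_ne_zero] at h1
      rw [← hyn, Real.log_pow]
      push_cast
      linarith [log_two_le_one]
    calc W * Real.log n ≤ y * y := mul_le_mul hWy hlog (Real.log_nonneg hn) hy0.le
      _ = n := by rw [← hyn]; ring
  · have h1 : Real.log n ≤ 2 * Real.log W := by
      have := Real.log_le_log hn0 hc.le
      rwa [Real.log_pow, Nat.cast_ofNat] at this
    nlinarith

/-- The sample size bounds both `(1 + 1 / ln (1 / r)) ln n` and
`(1 + 1 / ln (1 / r)) ln (2π / δ)` by small multiples of `n ε²`, and these two control every term of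
the truncation cost. -/
theorem truncation_cost_le_of_expSampleSize_lt {C r δ ε : ℝ} (hr0 : 0 < r) (hr1 : r < 1)
    (hδ : 0 < δ) (hδ1 : δ ≤ 1) (hε : 0 < ε) (hε1 : ε ≤ 1) {n : ℕ} (hn : 0 < n)
    (h : expSampleSize C r δ ε < n) :
    (1 + (Real.log n + Real.log (max C 1) + Real.log (1 + 1 / Real.log (1 / r)) +
      Real.log (1 / (δ / 2))) / Real.log (1 / r)) * Real.log 2 + Real.log (1 / (δ / 2))
        ≤ 2 * n * ε ^ 2 := by
  have hL : 0 < Real.log (1 / r) := log_one_div_pos hr0 hr1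
  have hD : 1 ≤ max C 1 := le_max_right _ _
  simp only [expSampleSize, max_lt_iff] at h
  obtain ⟨-, h2, h3⟩ := h
  set L := Real.log (1 / r)
  set D := max C 1
  have hn1 : (1 : ℝ) ≤ n := by exact_mod_cast hn
  have ha : 0 ≤ Real.log n := Real.log_nonneg hn1
  have he : 2 ≤ Real.exp 1 := by linarith [Real.exp_one_gt_d9]
  set u := 1 / L with hu
  have hu0 : 0 < u := by positivity
  set Y := 3 + Real.log (6 * Real.pi * Real.exp 3 / δ) / L with hY
  have hlogY : 3 ≤ Real.log (6 * Real.pi * Real.exp 3 / δ) := by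
    rw [Real.le_log_iff_exp_le (by positivity), le_div_iff₀ hδ]
    have : 1 ≤ 6 * Real.pi := by linarith [Real.pi_gt_three]
    nlinarith [Real.exp_pos 3]
  have hY3 : 3 * (1 + u) ≤ Y := by
    have := mul_le_mul_of_nonneg_right hlogY hu0.le
    rw [hY, div_eq_mul_one_div, ← hu]
    linarith
  have hY0 : 0 < Y := lt_of_lt_of_le (by positivity) hY3
  set q := Real.log (2 * Real.pi / δ) with hq
  have hdq : Real.log (1 / (δ / 2)) ≤ q := by
    refine Real.log_le_log (by positivity) ?_
    rw [one_div_div]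
    gcongr
    linarith [Real.pi_gt_three]
  have hd0 : 0 ≤ Real.log (1 / (δ / 2)) := log_one_div_nonneg (by positivity) (by linarith)
  have hq1 : 1 ≤ q := by
    refine one_le_log_two_pi.trans (Real.log_le_log (by positivity) ?_)
    rw [le_div_iff₀ hδ]
    nlinarith [Real.pi_pos]
  set v := D * (1 + u) with hv
  have hv1 : 1 + u ≤ v := le_mul_of_one_le_left (by positivity) hD
  have hDv : D * u ≤ v := by nlinarith
  have hv0 : 0 < v := by linarith
  set N := n * ε ^ 2 with hN
  have hNn : N ≤ n := mul_le_of_le_one_right (by positivity) (pow_le_one₀ hε.le hε1)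
  have hq12 : 12 * (v * q) ≤ N := by
    have h4 : 6 * Real.exp 1 * D / ε ^ 2 * (1 + u) * q = 6 * Real.exp 1 * (v * q) / ε ^ 2 := by
      rw [hv]; ring
    rw [h4, div_lt_iff₀ (by positivity)] at h3
    have : 0 ≤ v * q := by positivity
    nlinarith
  have ha36 : 36 * (v * Real.log n) ≤ N := by
    have h5 := mul_log_le_of_lt (W := 6 * Real.exp 1 * D / ε ^ 2 * Y) (by positivity) hn1
      (lt_of_eq_of_lt (by ring) h2)
    have h4 : 6 * Real.exp 1 * D / ε ^ 2 * Y * Real.log n =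
        6 * Real.exp 1 * (D * Y * Real.log n) / ε ^ 2 := by ring
    rw [h4, div_le_iff₀ (by positivity)] at h5
    have h6 : D * (3 * (1 + u)) * Real.log n ≤ D * Y * Real.log n := by gcongr
    have h7 : 0 ≤ D * Y * Real.log n := by positivity
    have h8 : D * (3 * (1 + u)) * Real.log n = 3 * (v * Real.log n) := by rw [hv]; ring
    nlinarith
  have hun : 1 + u ≤ n := by nlinarith
  have hlogu : Real.log (1 + u) ≤ Real.log n := Real.log_le_log (by positivity) hun
  have hlogu0 : 0 ≤ Real.log (1 + u) := Real.log_nonneg (by linarith)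
  have hlogD : Real.log D ≤ D := by
    linarith [Real.log_le_sub_one_of_pos (show 0 < D by linarith)]
  have hlogD0 : 0 ≤ Real.log D := Real.log_nonneg hD
  have h9 : (1 + (Real.log n + Real.log D + Real.log (1 + u) + Real.log (1 / (δ / 2))) / L)
      * Real.log 2 ≤ 1 + (2 * Real.log n + D + q) * u := by
    refine (mul_le_of_le_one_right (by positivity) log_two_le_one).trans ?_
    rw [div_eq_mul_one_div, ← hu]
    have := mul_le_mul_of_nonneg_right (show Real.log n + Real.log D + Real.log (1 + u) +
      Real.log (1 / (δ / 2)) ≤ 2 * Real.log n + D + q by linarith) hu0.le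
    linarith
  have h10 : u * Real.log n ≤ v * Real.log n := mul_le_mul_of_nonneg_right (by linarith) ha
  have h11 : u * q ≤ v * q := mul_le_mul_of_nonneg_right (by linarith) (by linarith)
  have h12 : v ≤ v * q := le_mul_of_one_le_right hv0.le hq1
  have h13 : q ≤ v * q := le_mul_of_one_le_left (by linarith) (by linarith)
  have h14 : 2 * n * ε ^ 2 = 2 * N := by rw [hN]; ring
  rw [h14]
  linarith

theorem exists_forall_add_mul_le_mul_sq (p q : ℝ) {k : ℝ} (hk : 0 < k) :
    ∃ x₀ : ℝ, 1 ≤ x₀ ∧ ∀ x, x₀ ≤ x → p + q * x ≤ k * x ^ 2 := by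
  refine ⟨max 1 ((|p| + |q|) / k), le_max_left _ _, fun x hx => ?_⟩
  have h1 : 1 ≤ x := (le_max_left _ _).trans hx
  have h2 : (|p| + |q|) / k ≤ x := (le_max_right _ _).trans hx
  rw [div_le_iff₀ hk] at h2
  have h3 : p ≤ |p| * x := (le_abs_self p).trans (le_mul_of_one_le_right (abs_nonneg p) h1)
  have h4 : q * x ≤ |q| * x := mul_le_mul_of_nonneg_right (le_abs_self q) (by linarith)
  nlinarith

/-- For small `ε`, a sample size of order `ε⁻² (ln (1/ε))²` beats every fixed affine function of
`ln n`. The bound on `n` is only from below, so `n ≥ ε⁻⁴` needs a separate argument, by the growth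
of `√n`. -/
theorem exists_forall_add_mul_log_le (p : ℝ) {q k : ℝ} (hq : 0 ≤ q) (hk : 0 < k) :
    ∃ ε₀ : ℝ, 0 < ε₀ ∧ ∀ ε : ℝ, 0 < ε → ε < ε₀ → ∀ n : ℝ,
      k * (1 / ε ^ 2 * Real.log (1 / ε) ^ 2) ≤ n → 0 < n ∧ p + q * Real.log n ≤ n * ε ^ 2 := by
  obtain ⟨x₀, hx₀, hx⟩ := exists_forall_add_mul_le_mul_sq p (4 * q) hk
  obtain ⟨x₁, hx₁, hx'⟩ := exists_forall_add_mul_le_mul_sq p (4 * q) one_pos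
  refine ⟨min 1 (min (Real.exp (-x₀)) (1 / x₁)), ?_, fun ε hε hεε n hn => ?_⟩
  · exact lt_min one_pos (lt_min (Real.exp_pos _) (by positivity))
  have hε1 : ε < 1 := hεε.trans_le (min_le_left _ _)
  have hε2 : ε < Real.exp (-x₀) := hεε.trans_le ((min_le_right _ _).trans (min_le_left _ _))
  have hε3 : ε < 1 / x₁ := hεε.trans_le ((min_le_right _ _).trans (min_le_right _ _))
  have hl : x₀ ≤ Real.log (1 / ε) := by
    have := (Real.log_lt_iff_lt_exp hε).2 hε2
    rw [one_div, Real.log_inv]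
    linarith
  have hl0 : 0 < Real.log (1 / ε) := by linarith
  have hn0 : 0 < n := lt_of_lt_of_le (by positivity) hn
  refine ⟨hn0, ?_⟩
  obtain hc | hc := le_or_gt ((1 / ε) ^ 4) n
  · set w := Real.sqrt (Real.sqrt n) with hw
    have hw0 : 0 < w := Real.sqrt_pos.2 (Real.sqrt_pos.2 hn0)
    have hwn : w ^ 4 = n := by
      rw [show w ^ 4 = (w ^ 2) ^ 2 by ring, hw, Real.sq_sqrt (Real.sqrt_nonneg n),
        Real.sq_sqrt hn0.le]
    have hwε : 1 / ε ≤ w := by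
      rw [← hwn] at hc
      exact le_of_pow_le_pow_left₀ (by norm_num) hw0.le hc
    have hw1 : x₁ ≤ w := by
      have : x₁ < 1 / ε := by
        rw [lt_div_iff₀ hε]
        rw [lt_div_iff₀ (by linarith)] at hε3
        linarith
      linarith
    have hlog : Real.log n ≤ 4 * w := by
      rw [← hwn, Real.log_pow]
      push_cast
      linarith [Real.log_le_sub_one_of_pos hw0]
    have hwε' : 1 ≤ w * ε := (div_le_iff₀ hε).1 hwε
    calc p + q * Real.log n ≤ p + 4 * q * w := by nlinarith
      _ ≤ 1 * w ^ 2 := hx' w hw1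
      _ ≤ (w * ε) ^ 2 * w ^ 2 :=
        mul_le_mul_of_nonneg_right (one_le_pow₀ hwε') (by positivity)
      _ = n * ε ^ 2 := by rw [← hwn]; ring
  · have hlog : Real.log n ≤ 4 * Real.log (1 / ε) := by
      have := Real.log_le_log hn0 hc.le
      rwa [Real.log_pow, Nat.cast_ofNat] at this
    have hn' : k * Real.log (1 / ε) ^ 2 ≤ n * ε ^ 2 := by
      calc k * Real.log (1 / ε) ^ 2 = k * (1 / ε ^ 2 * Real.log (1 / ε) ^ 2) * ε ^ 2 := by
            field_simp
        _ ≤ n * ε ^ 2 := mul_le_mul_of_nonneg_right hn (by positivity)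
    calc p + q * Real.log n ≤ p + 4 * q * Real.log (1 / ε) := by nlinarith
      _ ≤ k * Real.log (1 / ε) ^ 2 := hx _ hl
      _ ≤ n * ε ^ 2 := hn'

/-! ### Generalization bounds -/

/-- The constant term of the truncation cost for `δ₁ = δ₂ = δ / 2`, as an affine function of
`ln n`. -/
noncomputable def costConst (C r δ : ℝ) : ℝ :=
  (1 + (Real.log (max C 1) + Real.log (1 + 1 / Real.log (1 / r)) + Real.log (1 / (δ / 2))) /
    Real.log (1 / r)) * Real.log 2 + Real.log (1 / (δ / 2))

theorem le_measureReal_uniformlyGood_of_costConst_le {Z : Type u} [MeasurableSpace Z]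
    [DiscreteMeasurableSpace Z] (Q : Measure Z) [IsProbabilityMeasure Q] {C r : ℝ} (hr0 : 0 < r)
    (hr1 : r < 1) (hE : ExpDecay Q C r) {n : ℕ} (hn : 0 < n) {t δ : ℝ} (ht : 0 ≤ t) (hδ : 0 < δ)
    (hδ' : δ ≤ 1)
    (h : costConst C r δ + Real.log 2 / Real.log (1 / r) * Real.log n ≤ 2 * n * t ^ 2) :
    1 - δ ≤ (iidLaw Q n).real (uniformlyGood Q n t) := by
  have := le_measureReal_uniformlyGood Q hr0 hr1 hE hn ht (half_pos hδ) (half_pos hδ)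
    (by linarith) (le_trans (le_of_eq (by rw [costConst]; ring)) h)
  rwa [add_halves] at this

theorem ExpDecay.countable_and_nonempty {Z : Type u} [MeasurableSpace Z] {Q : Measure Z} {C r : ℝ}
    (hE : ExpDecay Q C r) : Countable Z ∧ Nonempty Z := by
  obtain ⟨num, -⟩ := hE
  exact ⟨num.symm.injective.countable, ⟨num 0⟩⟩

theorem le_measureReal_of_uniformlyGood_subset {Z : Type u} [MeasurableSpace Z] {Q : Measure Z}
    [IsProbabilityMeasure Q] {n : ℕ} {t p : ℝ} (h : p ≤ (iidLaw Q n).real (uniformlyGood Q n t))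
    {S : Set (Fin n → Z)} (hS : uniformlyGood Q n t ⊆ S) : p ≤ (iidLaw Q n).real S := by
  have : IsProbabilityMeasure (iidLaw Q n) := by unfold iidLaw; infer_instance
  exact h.trans (measureReal_mono hS)

/-- When the right-hand side is at least the diameter of the loss, the bound holds for every sample;
otherwise it dominates the truncation cost. -/
theorem le_measureReal_genGap_le_of_kappaBound {Z : Type u} {H : Type v} [MeasurableSpace Z]
    [DiscreteMeasurableSpace Z] (Q : Measure Z) [IsProbabilityMeasure Q] {C r : ℝ} (hr0 : 0 < r)
    (hr1 : r < 1) (hE : ExpDecay Q C r) (ℓ : H → Z → ℝ) (A : Learner Z H) {n : ℕ} (hn : 0 < n)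
    {δ₁ δ₂ s : ℝ} (hδ₁ : 0 < δ₁) (hδ₁' : δ₁ ≤ 1) (hδ₂ : 0 < δ₂) (hδ₂' : δ₂ ≤ 1) (hs : 0 ≤ s) :
    1 - (δ₁ + δ₂) ≤ (iidLaw Q n).real
      {z | (genGap ℓ Q z (A n z) : EReal) ≤ lossDiam ℓ *
        (Real.sqrt (((kappaBound C r n + s) *
          (3 * Real.log n + Real.log (2 * Real.pi) + Real.log (1 / δ₂)) +
            Real.log (1 / δ₁)) / (2 * (n : ℝ))) : ℝ)} := by
  obtain ⟨hcount, hne⟩ := hE.countable_and_nonempty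
  have hL : 0 < Real.log (1 / r) := log_one_div_pos hr0 hr1
  have hn1 : (1 : ℝ) ≤ n := by exact_mod_cast hn
  have ha : 0 ≤ Real.log (n : ℝ) := Real.log_nonneg hn1
  have hd1 := log_one_div_nonneg hδ₁ hδ₁'
  have hd2 := log_one_div_nonneg hδ₂ hδ₂'
  have hp := one_le_log_two_pi
  have hD : 0 < max C 1 := lt_max_of_lt_right one_pos
  have hκ : 0 < kappaBound C r n := by
    rw [kappaBound_eq hr0]
    positivity
  set R := (kappaBound C r n + s) *
    (3 * Real.log n + Real.log (2 * Real.pi) + Real.log (1 / δ₂)) + Real.log (1 / δ₁) with hRdef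
  have hR0 : 0 < R := by positivity
  set t := Real.sqrt (R / (2 * (n : ℝ))) with ht
  have ht0 : 0 < t := Real.sqrt_pos.2 (by positivity)
  obtain hc | hc := lt_or_ge R (2 * n)
  · refine le_measureReal_of_uniformlyGood_subset
      (le_measureReal_uniformlyGood Q hr0 hr1 hE hn ht0.le hδ₁ hδ₂ hδ₂' ?_) fun z hz =>
        genGap_le_of_mem_uniformlyGood hn ht0 hz ℓ _
    have hRt : 2 * n * t ^ 2 = R := by
      rw [ht, Real.sq_sqrt (by positivity)]
      field_simp
    rw [hRt]
    rw [hRdef, kappaBound_eq hr0] at hc ⊢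
    exact truncation_cost_le hL (le_max_right _ _) hn1 hδ₁ hδ₁' hδ₂ hδ₂' hs hc
  · have ht1 : 1 ≤ t := by
      rw [ht, Real.one_le_sqrt, le_div_iff₀ (by positivity)]
      linarith
    have hall : ∀ z : Fin n → Z, (genGap ℓ Q z (A n z) : EReal) ≤ lossDiam ℓ * (t : EReal) := by
      intro z
      have : Nonempty H := ⟨A n z⟩
      refine (genGap_le_lossDiam Q hn z ℓ _).trans ?_
      obtain htop | ⟨a, b, hab, hd, -⟩ := lossDiam_eq_top_or ℓ
      · rw [htop, EReal.top_mul_coe_of_pos ht0]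
      · rw [hd, ← EReal.coe_mul]
        exact EReal.coe_le_coe_iff.2 (le_mul_of_one_le_right (sub_nonneg.2 hab) ht1)
    have : IsProbabilityMeasure (iidLaw Q n) := by unfold iidLaw; infer_instance
    rw [show {z : Fin n → Z | (genGap ℓ Q z (A n z) : EReal) ≤ lossDiam ℓ * (t : EReal)} = Set.univ
      from Set.eq_univ_of_forall hall, probReal_univ]
    linarith

end RenyiGen

theorem mainTheorem7 :
    -- The explicit bounds.
    (∀ (C r : ℝ), 0 < C → 0 < r → r < 1 →
      ∀ (Z : Type u) (H : Type v) [MeasurableSpace Z] [DiscreteMeasurableSpace Z]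
        (Q : Measure Z) [IsProbabilityMeasure Q], RenyiGen.ExpDecay Q C r →
      ∀ (ℓ : H → Z → ℝ) (A : RenyiGen.Learner Z H), A.IsSymmetric →
        (∀ n : ℕ, 0 < n →
          RenyiGen.kappaStar Q n ≤ ENNReal.ofReal (RenyiGen.kappaBound C r n)) ∧
        (∀ n : ℕ, 0 < n → ∀ δ₁ δ₂ δ₃ : ℝ, 0 < δ₁ → 0 < δ₂ → 0 < δ₃ →
          1 - (δ₁ + δ₂ + δ₃) ≤ (RenyiGen.iidLaw Q n).real
            {z | (RenyiGen.genGap ℓ Q z (A n z) : EReal) ≤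
              RenyiGen.lossDiam ℓ *
                (Real.sqrt
                  (((RenyiGen.kappaBound C r n + Real.sqrt ((n : ℝ) / 2 * Real.log (2 / δ₃))) *
                      (3 * Real.log n + Real.log (2 * Real.pi) + Real.log (1 / δ₂)) +
                    Real.log (1 / δ₁)) / (2 * (n : ℝ))) : ℝ)}) ∧
        (0 < RenyiGen.lossDiam ℓ →
          ∀ δ ε : ℝ, 0 < δ → δ ≤ 1 → 0 < ε → ε ≤ 1 → ∀ n : ℕ,
            RenyiGen.omega δ ε < (n : ℝ) → RenyiGen.expSampleSize C r δ ε < (n : ℝ) →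
            1 - δ ≤ (RenyiGen.iidLaw Q n).real
              {z | (RenyiGen.genGap ℓ Q z (A n z) : EReal) <
                RenyiGen.lossDiam ℓ * (ε : EReal)})) ∧
    -- The order of the generalization gap as the sample size grows.
    (∃ K : ℝ, 0 < K ∧ ∀ (C r δ : ℝ), 0 < C → 0 < r → r < 1 → 0 < δ → δ ≤ 1 →
      ∃ n₀ : ℕ, ∀ (Z : Type u) (H : Type v) [MeasurableSpace Z] [DiscreteMeasurableSpace Z]
        (Q : Measure Z) [IsProbabilityMeasure Q], RenyiGen.ExpDecay Q C r →
      ∀ (ℓ : H → Z → ℝ) (A : RenyiGen.Learner Z H), A.IsSymmetric → ∀ n : ℕ, n₀ ≤ n →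
        1 - δ ≤ (RenyiGen.iidLaw Q n).real
          {z | (RenyiGen.genGap ℓ Q z (A n z) : EReal) ≤
            RenyiGen.lossDiam ℓ *
              (K * Real.sqrt (Real.exp 1 * C / Real.log (1 / r) *
                ((Real.log n) ^ 2 / (2 * (n : ℝ)))) : ℝ)}) ∧
    -- The order of a sufficient sample size as the accuracy improves.
    (∃ K : ℝ, 0 < K ∧ ∀ (C r δ : ℝ), 0 < C → 0 < r → r < 1 → 0 < δ → δ ≤ 1 →
      ∃ ε₀ : ℝ, 0 < ε₀ ∧ ∀ (Z : Type u) (H : Type v) [MeasurableSpace Z]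
        [DiscreteMeasurableSpace Z] (Q : Measure Z) [IsProbabilityMeasure Q],
        RenyiGen.ExpDecay Q C r →
      ∀ (ℓ : H → Z → ℝ) (A : RenyiGen.Learner Z H), A.IsSymmetric → 0 < RenyiGen.lossDiam ℓ →
      ∀ ε : ℝ, 0 < ε → ε < ε₀ → ∀ n : ℕ,
        K * (1 / (ε ^ 2 * Real.log (1 / r)) * (Real.log (1 / ε)) ^ 2) ≤ (n : ℝ) →
        1 - δ ≤ (RenyiGen.iidLaw Q n).real
          {z | (RenyiGen.genGap ℓ Q z (A n z) : EReal) <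
            RenyiGen.lossDiam ℓ * (ε : EReal)}) := by
  open RenyiGen in
  refine ⟨?_, ?_, ?_⟩
  · intro C r _ hr0 hr1 Z H _ _ Q _ hE ℓ A _
    obtain ⟨hcount, hne⟩ := hE.countable_and_nonempty
    refine ⟨fun n hn => kappaStar_le_kappaBound Q hr0 hr1 hE hn, ?_, ?_⟩
    · intro n hn δ₁ δ₂ δ₃ h1 h2 h3
      obtain hδ | hδ := le_or_gt 1 (δ₁ + δ₂ + δ₃)
      · exact (by linarith : 1 - (δ₁ + δ₂ + δ₃) ≤ 0).trans measureReal_nonneg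
      · refine le_trans (by linarith) (le_measureReal_genGap_le_of_kappaBound Q hr0 hr1 hE ℓ A hn
          h1 (by linarith) h2 (by linarith) (Real.sqrt_nonneg _))
    · intro hℓ δ ε hδ hδ1 hε hε1 n _ hn
      have hn0 : 0 < n := by
        rcases Nat.eq_zero_or_pos n with rfl | hpos
        · exfalso
          have : 0 ≤ expSampleSize C r δ ε := le_max_of_le_left (mul_nonneg (div_nonneg
            (by positivity) (mul_nonneg (sq_nonneg _) (log_one_div_pos hr0 hr1).le)) (sq_nonneg _))
          rw [Nat.cast_zero] at hn
          linarith
        · exact hpos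
      have := le_measureReal_uniformlyGood Q hr0 hr1 hE hn0 hε.le (half_pos hδ) (half_pos hδ)
        (by linarith) (truncation_cost_le_of_expSampleSize_lt hr0 hr1 hδ hδ1 hε hε1 hn0 hn)
      rw [add_halves] at this
      exact le_measureReal_of_uniformlyGood_subset this fun z hz =>
        genGap_lt_of_mem_uniformlyGood hε hz ℓ hℓ _
  · refine ⟨1, one_pos, fun C r δ hC hr0 hr1 hδ hδ1 => ?_⟩
    have hL := log_one_div_pos hr0 hr1
    obtain ⟨x₀, hx₀, hx⟩ := exists_forall_add_mul_le_mul_sq (costConst C r δ)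
      (Real.log 2 / Real.log (1 / r)) (k := Real.exp 1 * C / Real.log (1 / r)) (by positivity)
    refine ⟨⌈Real.exp x₀⌉₊, fun Z H _ _ Q _ hE ℓ A _ n hn => ?_⟩
    obtain ⟨hcount, hne⟩ := hE.countable_and_nonempty
    have hn' : Real.exp x₀ ≤ n := Nat.ceil_le.1 hn
    have hn0' : (0 : ℝ) < n := (Real.exp_pos _).trans_le hn'
    have hn0 : 0 < n := by exact_mod_cast hn0'
    have hlog : x₀ ≤ Real.log n := (Real.le_log_iff_exp_le hn0').2 hn'
    have hlog0 : 0 < Real.log n := by linarith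
    set t := Real.sqrt (Real.exp 1 * C / Real.log (1 / r) *
      ((Real.log n) ^ 2 / (2 * (n : ℝ)))) with ht
    have ht0 : 0 < t := Real.sqrt_pos.2 (by positivity)
    rw [one_mul]
    refine le_measureReal_of_uniformlyGood_subset (le_measureReal_uniformlyGood_of_costConst_le Q
      hr0 hr1 hE hn0 ht0.le hδ hδ1 ((hx _ hlog).trans (le_of_eq ?_))) fun z hz =>
        genGap_le_of_mem_uniformlyGood hn0 ht0 hz ℓ _
    rw [ht, Real.sq_sqrt (by positivity)]
    field_simp
  · refine ⟨1, one_pos, fun C r δ hC hr0 hr1 hδ hδ1 => ?_⟩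
    have hL := log_one_div_pos hr0 hr1
    obtain ⟨ε₀, hε₀, hε₀'⟩ := exists_forall_add_mul_log_le (costConst C r δ)
      (q := Real.log 2 / Real.log (1 / r)) (k := 1 / Real.log (1 / r)) (by positivity)
      (by positivity)
    refine ⟨ε₀, hε₀, fun Z H _ _ Q _ hE ℓ A _ hℓ ε hε hεε n hn => ?_⟩
    obtain ⟨hcount, hne⟩ := hE.countable_and_nonempty
    obtain ⟨hn0, hcost⟩ := hε₀' ε hε hεε n (le_trans (le_of_eq (by field_simp)) hn)
    have hnε : 0 ≤ n * ε ^ 2 := by positivity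
    exact le_measureReal_of_uniformlyGood_subset (le_measureReal_uniformlyGood_of_costConst_le Q
      hr0 hr1 hE (by exact_mod_cast hn0) hε.le hδ hδ1 (by linarith)) fun z hz =>
        genGap_lt_of_mem_uniformlyGood hε hz ℓ hℓ _
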